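/- Let $M$ be a matroid on $n$ elements that is representable over a field $K$; that is, there is a matrix over $K$ with columns indexed by the elements of $M$ such that a set of elements is independent in $M$ if and only if the corresponding family of columns is linearly independent over $K$. Then $M$ is representable over some simple algebraic extension $L = P(a)$ of the prime field $P$ of $K$, where $a$ is algebraic over $P$, of degree $$[L:P] \le 2^{2^{2n^2}}.$$ -/

import Mathlib

universe u v

/-- A matroid `M` is representable over the field `F` if there is a matrix over `F` with finitely
many rows and with columns indexed by the elements of `M`, such that a set of elements is
independent in `M` if and only if the family of the corresponding columns is linearly independent.
(Columns indexed by elements of the ambient type outside the ground set play no role.) -/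
def Matroid.IsRepresentableOver {α : Type u} (M : Matroid α) (F : Type v) [Field F] : Prop :=
  ∃ (m : ℕ) (A : Matrix (Fin m) α F), ∀ I ⊆ M.E, M.Indep I ↔ LinearIndepOn F A.col I

/-- `L` is a simple algebraic extension of `k`: it is generated as a field over `k` by a single
algebraic element. -/
def IsSimpleAlgebraicExtension (k : Type u) (L : Type v) [Field k] [Field L] [Algebra k L] : Prop :=
  ∃ a : L, IsAlgebraic k a ∧ IntermediateField.adjoin k {a} = ⊤

/-! If the ground set is independent, unit vectors work over the prime field `P`. Otherwise the
columns span dimension `r < n`, so the representation is an `n × r` array of unknowns subject to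
minor conditions: dependent sets give equations, and one nonzero minor per independent set,
multiplied together, gives a single inequation. The system is solvable in `K`; a solution of bounded
degree over `P` is needed.

Variables are eliminated one at a time (`exists_elimination`). With the others fixed, a common root
of `S` avoiding `g` exists in some extension unless `g ^ d` lies in the ideal of `S`. With degrees
controlled, that membership is linear algebra, and its failure is certified by minors, polynomials
in the remaining variables. Each elimination turns the degree bound `d` into `d ^ 4` and costs an
extension of degree at most `d + 1`. Simplicity follows since `P` is perfect. -/

section Elimination

open Polynomial

theorem linearIndependent_iff_exists_det_ne_zero {K ι κ : Type*} [Field K] [Fintype ι]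
    [DecidableEq ι] [Finite κ] (v : ι → κ → K) :
    LinearIndependent K v ↔ ∃ c : ι → κ, (Matrix.of fun i j => v i (c j)).det ≠ 0 := by
  have := Fintype.ofFinite κ
  constructor
  · intro hv
    have hr : Module.finrank K (Submodule.span K (Set.range (Matrix.of v).col)) =
        Fintype.card ι := by
      rw [← Matrix.rank_eq_finrank_span_cols]
      exact LinearIndependent.rank_matrix hv
    obtain ⟨f, hf, -, hli⟩ :=
      Submodule.exists_fun_fin_finrank_span_eq K (Set.range (Matrix.of v).col)
    let e : ι ≃ Fin (Module.finrank K (Submodule.span K (Set.range (Matrix.of v).col))) :=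
      Fintype.equivOfCardEq (by simp [hr])
    choose c hc using hf
    refine ⟨c ∘ e, ?_⟩
    have hcol : LinearIndependent K (Matrix.of fun i j => v i ((c ∘ e) j)).col := by
      have : (Matrix.of fun i j => v i ((c ∘ e) j)).col = f ∘ e := by
        funext j
        exact hc (e j)
      rw [this]
      exact hli.comp _ e.injective
    rw [Matrix.linearIndependent_cols_iff_isUnit, Matrix.isUnit_iff_isUnit_det] at hcol
    exact hcol.ne_zero
  · rintro ⟨c, hc⟩
    exact LinearIndependent.of_comp (LinearMap.funLeft K K c)
      (Matrix.linearIndependent_rows_of_det_ne_zero hc)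

/-! ### Univariate polynomials: common roots and ideal membership with degree bounds -/

namespace Polynomial

/-- If every irreducible factor of `h` divides `g`, then `h` divides a power of `g` with exponent
at least the degree of `h`. -/
theorem dvd_pow_of_irreducible_dvd {F : Type*} [Field F] {g h : F[X]} (h0 : h ≠ 0)
    (hg : ∀ q, Irreducible q → q ∣ h → q ∣ g) {d : ℕ} (hd : h.natDegree ≤ d) : h ∣ g ^ d := by
  induction h using WfDvdMonoid.induction_on_irreducible generalizing d with
  | zero => exact absurd rfl h0
  | unit u hu => exact hu.dvd
  | mul a q ha hq ih =>
    rw [natDegree_mul hq.ne_zero ha] at hd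
    have hq1 := hq.natDegree_pos
    obtain ⟨d, rfl⟩ : ∃ e, d = e + 1 := ⟨d - 1, by omega⟩
    rw [pow_succ']
    exact mul_dvd_mul (hg q hq (dvd_mul_right _ _))
      (ih ha (fun p hp hpa => hg p hp (hpa.mul_left _)) (by omega))

/-- Over an extension of degree at most `d + 1` the polynomials in `S` have a common root that is
not a root of `g`, unless `g ^ d` lies in the ideal generated by `S`. -/
theorem exists_extension_root {F : Type u} [Field F] {S : Set F[X]} {g : F[X]} {d : ℕ}
    (hS : ∀ f ∈ S, f.natDegree ≤ d) (hgd : g.natDegree ≤ d) (hd : d ≠ 0)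
    (h : g ^ d ∉ Ideal.span S) :
    ∃ (L : Type u) (_ : Field L) (_ : Algebra F L), FiniteDimensional F L ∧
      Module.finrank F L ≤ d + 1 ∧ ∃ x : L, (∀ f ∈ S, aeval x f = 0) ∧ aeval x g ≠ 0 := by
  have key : ∀ q : F[X], Irreducible q → q.natDegree ≤ d + 1 → (∀ f ∈ S, q ∣ f) → ¬ q ∣ g →
      ∃ (L : Type u) (_ : Field L) (_ : Algebra F L), FiniteDimensional F L ∧
        Module.finrank F L ≤ d + 1 ∧ ∃ x : L, (∀ f ∈ S, aeval x f = 0) ∧ aeval x g ≠ 0 := by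
    intro q hq hqd hqS hqg
    have := Fact.mk hq
    refine ⟨AdjoinRoot q, inferInstance, inferInstance,
      (AdjoinRoot.powerBasis hq.ne_zero).finite, ?_, AdjoinRoot.root q, ?_, ?_⟩
    · rw [(AdjoinRoot.powerBasis hq.ne_zero).finrank, AdjoinRoot.powerBasis_dim]
      exact hqd
    · intro f hf
      rw [AdjoinRoot.aeval_eq, AdjoinRoot.mk_eq_zero]
      exact hqS f hf
    · rwa [AdjoinRoot.aeval_eq, Ne, AdjoinRoot.mk_eq_zero]
  by_cases hS0 : ∀ f ∈ S, f = 0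
  · have hg0 : g ≠ 0 := by
      rintro rfl
      exact h (by simp [hd])
    -- With no equations, any irreducible factor of `X * g + 1` works, being coprime to `g`; this
    -- case accounts for the `+ 1` in the degree bound.
    have hdeg : (X * g + 1 : F[X]).natDegree = g.natDegree + 1 := by
      rw [← C_1, natDegree_add_C, natDegree_X_mul hg0]
    obtain ⟨q, hq, hqd⟩ := exists_irreducible_of_natDegree_ne_zero
      (f := X * g + 1) (by omega)
    refine key q hq ?_ (fun f hf => by simp [hS0 f hf]) ?_
    · have := natDegree_le_of_dvd hqd (by intro h0; simp [h0] at hdeg)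
      omega
    · intro hqg
      exact hq.not_isUnit (isUnit_of_dvd_one ((dvd_add_right (hqg.mul_left X)).1 hqd))
  · push Not at hS0
    obtain ⟨f₀, hf₀, hne⟩ := hS0
    obtain ⟨p, hp⟩ := IsPrincipalIdealRing.principal (Ideal.span S)
    have hp : Ideal.span S = Ideal.span {p} := hp
    have hdvd : ∀ f ∈ S, p ∣ f := fun f hf => by
      rw [← Ideal.mem_span_singleton, ← hp]
      exact Ideal.subset_span hf
    have hp0 : p ≠ 0 := by
      rintro rfl
      exact hne (zero_dvd_iff.1 (hdvd _ hf₀))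
    have hpd : p.natDegree ≤ d := (natDegree_le_of_dvd (hdvd _ hf₀) hne).trans (hS _ hf₀)
    rw [hp, Ideal.mem_span_singleton] at h
    by_contra hcon
    refine h (dvd_pow_of_irreducible_dvd hp0 (fun q hq hqp => ?_) hpd)
    by_contra hqg
    exact hcon (key q hq ((natDegree_le_of_dvd hqp hp0).trans (by omega))
      (fun f hf => hqp.trans (hdvd f hf)) hqg)

/-- An element of the ideal generated by `S` is a combination of the elements of `S` whose
coefficients have controlled degrees. -/
theorem mem_span_X_pow_mul_of_mem_ideal_span {F ι : Type*} [Field F] {f : ι → F[X]}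
    {p : F[X]} {d m : ℕ} (hf : ∀ i, (f i).natDegree ≤ d) (hdm : 2 * d ≤ m) (hp : p.natDegree ≤ m)
    (h : p ∈ Ideal.span (Set.range f)) :
    p ∈ Submodule.span F (Set.range fun s : ι × Fin (m + 1) => X ^ (s.2 : ℕ) * f s.1) := by
  set W := Submodule.span F (Set.range fun s : ι × Fin (m + 1) => X ^ (s.2 : ℕ) * f s.1)
  have hW : ∀ (i : ι) (c : F[X]), c.natDegree ≤ m → c * f i ∈ W := by
    intro i c hc
    rw [c.as_sum_range_C_mul_X_pow, Finset.sum_mul]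
    refine Submodule.sum_mem _ fun j hj => ?_
    rw [mul_assoc, ← smul_eq_C_mul]
    refine Submodule.smul_mem _ _ (Submodule.subset_span ⟨(i, ⟨j, ?_⟩), rfl⟩)
    have := Finset.mem_range.1 hj
    omega
  by_cases h0 : ∀ i, f i = 0
  · have : Ideal.span (Set.range f) = ⊥ := by
      rw [Ideal.span_eq_bot]
      rintro _ ⟨i, rfl⟩
      exact h0 i
    rw [this, Ideal.mem_bot] at h
    simp [h]
  · push Not at h0
    obtain ⟨i₀, hi₀⟩ := h0
    -- Coefficients are reduced modulo `f i₀` and the quotients collected into `c`. Since `p` and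
    -- `w` have degree at most `m`, so does `c * f i₀`, which bounds `c`.
    have hdec : ∃ w c : F[X], w ∈ W ∧ w.natDegree ≤ m ∧ p = w + c * f i₀ := by
      obtain ⟨c, hc⟩ := Finsupp.mem_span_range_iff_exists_finsupp.1 h
      have hr : ∀ i, (c i % f i₀).natDegree ≤ d := fun i => by
        by_cases h1 : (f i₀).natDegree = 0
        · obtain ⟨a, ha⟩ := natDegree_eq_zero.1 h1
          have ha0 : a ≠ 0 := by rintro rfl; exact hi₀ (by simp [← ha])
          rw [← ha, EuclideanDomain.mod_eq_zero.2 (isUnit_C.2 ha0.isUnit).dvd]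
          simp
        · exact (natDegree_mod_lt _ h1).le.trans (hf i₀)
      refine ⟨∑ i ∈ c.support, (c i % f i₀) * f i, ∑ i ∈ c.support, (c i / f i₀) * f i,
        Submodule.sum_mem _ fun i _ => hW i _ ((hr i).trans (by omega)),
        natDegree_sum_le_of_forall_le _ _ fun i _ =>
          natDegree_mul_le.trans ((add_le_add (hr i) (hf i)).trans (by omega)), ?_⟩
      rw [← hc, Finsupp.sum, Finset.sum_mul, ← Finset.sum_add_distrib]
      refine Finset.sum_congr rfl fun i _ => ?_
      conv_lhs => rw [smul_eq_mul, ← EuclideanDomain.mod_add_div (c i) (f i₀)]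
      ring
    obtain ⟨w, c, hw, hwm, rfl⟩ := hdec
    refine W.add_mem hw (hW _ _ ?_)
    by_cases hc : c = 0
    · simp [hc]
    have h1 : (c * f i₀).natDegree ≤ m := by
      have : c * f i₀ = (w + c * f i₀) - w := by ring
      rw [this]
      exact (natDegree_sub_le _ _).trans (max_le hp hwm)
    rw [natDegree_mul hc hi₀] at h1
    omega

end Polynomial

/-! ### Minors certifying non-membership in a span -/

/-- Here `ρ` is the rank of `w`, and adjoining `u` to a basis of rows raises it. The resulting
conditions are polynomial in the entries, so by `notMem_span_of_minors` they carry over to other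
fields and points. -/
theorem exists_minors_of_notMem_span {K σ τ : Type*} [Field K] [Fintype τ] {w : σ → τ → K}
    {u : τ → K} (hu : u ∉ Submodule.span K (Set.range w)) :
    ∃ (ρ : ℕ) (r : Fin ρ → σ) (c : Fin (ρ + 1) → τ), ρ < Fintype.card τ ∧
      (Matrix.of fun i j => (Fin.cons u (w ∘ r) : Fin (ρ + 1) → τ → K) i (c j)).det ≠ 0 ∧
      ∀ (r' : Fin (ρ + 1) → σ) (c' : Fin (ρ + 1) → τ),
        (Matrix.of fun i j => w (r' i) (c' j)).det = 0 := by
  obtain ⟨f, hf, hspan, hli⟩ := Submodule.exists_fun_fin_finrank_span_eq K (Set.range w)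
  choose r hr using hf
  have hwr : w ∘ r = f := funext hr
  have hcons : LinearIndependent K (Fin.cons u (w ∘ r) : Fin (_ + 1) → τ → K) := by
    rw [linearIndependent_finCons, hwr, hspan]
    exact ⟨hli, hu⟩
  obtain ⟨c, hc⟩ := (linearIndependent_iff_exists_det_ne_zero _).1 hcons
  refine ⟨_, r, c, ?_, hc, fun r' c' => ?_⟩
  · have := hcons.fintype_card_le_finrank
    simp only [Fintype.card_fin, Module.finrank_fintype_fun_eq_card] at this
    omega
  · by_contra h
    have hli' := (linearIndependent_iff_exists_det_ne_zero fun i => w (r' i)).2 ⟨c', h⟩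
    have h1 := finrank_span_eq_card hli'
    have h2 : Submodule.span K (Set.range fun i => w (r' i)) ≤
        Submodule.span K (Set.range w) :=
      Submodule.span_mono (by rintro _ ⟨i, rfl⟩; exact ⟨_, rfl⟩)
    have := Submodule.finrank_mono h2
    rw [h1, Fintype.card_fin] at this
    omega

theorem notMem_span_of_minors {K σ τ : Type*} [Field K] [Finite τ] {w : σ → τ → K}
    {u : τ → K} {ρ : ℕ} {r : Fin ρ → σ} {c : Fin (ρ + 1) → τ}
    (hc : (Matrix.of fun i j => (Fin.cons u (w ∘ r) : Fin (ρ + 1) → τ → K) i (c j)).det ≠ 0)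
    (h0 : ∀ (r' : Fin (ρ + 1) → σ) (c' : Fin (ρ + 1) → τ),
      (Matrix.of fun i j => w (r' i) (c' j)).det = 0) :
    u ∉ Submodule.span K (Set.range w) := by
  have := Fintype.ofFinite τ
  intro hu
  have hli := (linearIndependent_iff_exists_det_ne_zero _).2 ⟨c, hc⟩
  have hle : ρ + 1 ≤ Module.finrank K (Submodule.span K (Set.range w)) := by
    have h1 := finrank_span_eq_card hli
    rw [Fintype.card_fin] at h1
    rw [← h1]
    refine Submodule.finrank_mono (Submodule.span_le.2 ?_)
    rintro _ ⟨i, rfl⟩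
    induction i using Fin.cases with
    | zero => exact hu
    | succ i => exact Submodule.subset_span ⟨r i, rfl⟩
  obtain ⟨f, hf, -, hfli⟩ := Submodule.exists_fun_fin_finrank_span_eq K (Set.range w)
  choose s hs using hf
  have hli' : LinearIndependent K fun i => w (s (Fin.castLE hle i)) := by
    simp only [hs]
    exact hfli.comp _ (Fin.castLE_injective hle)
  obtain ⟨c', hc'⟩ := (linearIndependent_iff_exists_det_ne_zero _).1 hli'
  exact hc' (h0 _ c')

/-! ### Elimination of variables -/

namespace MvPolynomial

theorem totalDegree_det_le {R σ ι : Type*} [CommRing R] [Fintype ι] [DecidableEq ι]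
    (A : Matrix ι ι (MvPolynomial σ R)) (e : ι → ℕ) (h : ∀ i j, (A i j).totalDegree ≤ e i) :
    A.det.totalDegree ≤ ∑ i, e i := by
  rw [Matrix.det_apply]
  refine totalDegree_finsetSum_le fun s _ => ?_
  have hprod : (∏ i, A (s i) i).totalDegree ≤ ∑ i, e i := by
    refine (totalDegree_finsetProd _ _).trans ?_
    rw [← Equiv.sum_comp s e]
    exact Finset.sum_le_sum fun i _ => h _ _
  rcases Int.units_eq_one_or (Equiv.Perm.sign s) with hs | hs <;> simpa [hs] using hprod

theorem totalDegree_coeff_finSuccEquiv_le {R : Type*} [CommSemiring R] {k : ℕ}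
    (f : MvPolynomial (Fin (k + 1)) R) (i : ℕ) :
    ((finSuccEquiv R k f).coeff i).totalDegree ≤ f.totalDegree := by
  by_cases h : (finSuccEquiv R k f).coeff i = 0
  · simp [h]
  · exact (Nat.le_add_right _ _).trans (totalDegree_coeff_finSuccEquiv_add_le f i h)

/-- The univariate polynomial obtained by evaluating all but the first variable. -/
noncomputable def evalTail {P L : Type*} [Field P] [Field L] [Algebra P L] {k : ℕ}
    (b : Fin k → L) : MvPolynomial (Fin (k + 1)) P →+* L[X] :=
  (Polynomial.mapRingHom (aeval (R := P) b).toRingHom).comp (finSuccEquiv P k).toRingEquiv.toRingHom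

section evalTail

variable {P L : Type*} [Field P] [Field L] [Algebra P L] {k : ℕ} (b : Fin k → L)

theorem coeff_evalTail (f : MvPolynomial (Fin (k + 1)) P) (i : ℕ) :
    (evalTail b f).coeff i = aeval b ((finSuccEquiv P k f).coeff i) := by
  simp [evalTail]

theorem natDegree_evalTail_le (f : MvPolynomial (Fin (k + 1)) P) :
    (evalTail b f).natDegree ≤ f.totalDegree := by
  refine Polynomial.natDegree_map_le.trans ?_
  refine Eq.trans_le (natDegree_finSuccEquiv f) (degreeOf_le_totalDegree f 0)

theorem aeval_cons_eq_aeval_evalTail {L' : Type*} [Field L'] [Algebra P L'] [Algebra L L']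
    [IsScalarTower P L L'] (x : L') (f : MvPolynomial (Fin (k + 1)) P) :
    aeval (Fin.cons x fun i => algebraMap L L' (b i) : Fin (k + 1) → L') f =
      Polynomial.aeval x (evalTail b f) := by
  induction f using MvPolynomial.induction_on with
  | C a =>
    simp [evalTail, finSuccEquiv_apply, ← IsScalarTower.algebraMap_apply]
  | add p q hp hq => simp only [map_add, hp, hq]
  | mul_X p i hp =>
    rw [map_mul, map_mul, map_mul, hp]
    congr 1
    induction i using Fin.cases with
    | zero => simp [evalTail, finSuccEquiv_X_zero]
    | succ i => simp [evalTail, finSuccEquiv_X_succ]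

theorem aeval_coeff_X_pow_mul (f : MvPolynomial (Fin (k + 1)) P) (j c : ℕ) :
    aeval b ((Polynomial.X ^ j * finSuccEquiv P k f).coeff c) =
      (Polynomial.X ^ j * evalTail b f).coeff c := by
  simp only [Polynomial.coeff_X_pow_mul', coeff_evalTail]
  split_ifs <;> simp

theorem aeval_det_cons {τ ι : Type*} {ρ : ℕ} (u : τ → MvPolynomial ι P)
    (w : Fin ρ → τ → MvPolynomial ι P) (c : Fin (ρ + 1) → τ) (b : ι → L) :
    aeval b (Matrix.of fun i j => (Fin.cons u w : Fin (ρ + 1) → τ → _) i (c j)).det =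
      (Matrix.of fun i j => (Fin.cons (fun t => aeval b (u t)) (fun s t => aeval b (w s t)) :
        Fin (ρ + 1) → τ → L) i (c j)).det := by
  rw [AlgHom.map_det]
  congr 1
  ext i j
  induction i using Fin.cases <;> rfl

end evalTail

/-- Elimination of one variable from a system of equations `S` and one inequation `g`, along a
solution `a`. -/
theorem exists_elimination {P K : Type*} [Field P] [Field K] [Algebra P K] {k d : ℕ} (hd : 3 ≤ d)
    (S : Set (MvPolynomial (Fin (k + 1)) P)) (g : MvPolynomial (Fin (k + 1)) P)
    (hS : ∀ f ∈ S, f.totalDegree ≤ d) (hg : g.totalDegree ≤ d) (x : K) (a : Fin k → K)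
    (haS : ∀ f ∈ S, aeval (Fin.cons x a : Fin (k + 1) → K) f = 0)
    (hag : aeval (Fin.cons x a : Fin (k + 1) → K) g ≠ 0) :
    ∃ (S' : Set (MvPolynomial (Fin k) P)) (g' : MvPolynomial (Fin k) P),
      (∀ f ∈ S', f.totalDegree ≤ d ^ 4) ∧ g'.totalDegree ≤ d ^ 4 ∧
      (∀ f ∈ S', aeval a f = 0) ∧ aeval a g' ≠ 0 ∧
      ∀ (L : Type v) [Field L] [Algebra P L] (b : Fin k → L),
        (∀ f ∈ S', aeval b f = 0) → aeval b g' ≠ 0 →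
          evalTail b g ^ d ∉
            Ideal.span (Set.range fun f : S => evalTail b (f : MvPolynomial _ P)) := by
  -- Multipliers `X ^ j` with `j ≤ d ^ 2` suffice, as `g ^ d` has degree at most `d ^ 2`; the
  -- products have degree at most `d ^ 2 + d`, which fixes the row length.
  let w : S × Fin (d ^ 2 + 1) → Fin (d ^ 2 + d + 1) → MvPolynomial (Fin k) P := fun s c =>
    (Polynomial.X ^ (s.2 : ℕ) * finSuccEquiv P k (s.1 : MvPolynomial _ P)).coeff c
  let u : Fin (d ^ 2 + d + 1) → MvPolynomial (Fin k) P := fun c =>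
    (finSuccEquiv P k (g ^ d)).coeff c
  have hwd : ∀ s c, (w s c).totalDegree ≤ d := fun s c => by
    simp only [w, Polynomial.coeff_X_pow_mul']
    split_ifs
    · exact (totalDegree_coeff_finSuccEquiv_le _ _).trans (hS _ s.1.2)
    · simp
  have hud : ∀ c, (u c).totalDegree ≤ d ^ 2 := fun c => by
    refine (totalDegree_coeff_finSuccEquiv_le _ _).trans ((totalDegree_pow _ _).trans ?_)
    rw [sq]
    exact Nat.mul_le_mul_left d hg
  -- evaluation at the last coordinate separates `g ^ d` from the span of the rows
  have hsep : (fun c => aeval a (u c)) ∉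
      Submodule.span K (Set.range fun s c => aeval a (w s c)) := by
    let φ : (Fin (d ^ 2 + d + 1) → K) →ₗ[K] K :=
      Fintype.linearCombination K fun c : Fin (d ^ 2 + d + 1) => x ^ (c : ℕ)
    have hφ : ∀ p : K[X], p.natDegree < d ^ 2 + d + 1 → φ (fun c => p.coeff c) = p.eval x := by
      intro p hp
      rw [Polynomial.eval_eq_sum_range' hp, Fintype.linearCombination_apply,
        Finset.sum_range fun i => p.coeff i * x ^ i]
      rfl
    have hev : ∀ f : MvPolynomial (Fin (k + 1)) P,
        (evalTail a f).eval x = aeval (Fin.cons x a : Fin (k + 1) → K) f := fun f =>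
      (aeval_cons_eq_aeval_evalTail a x f).symm
    intro hmem
    have hle : Submodule.span K (Set.range fun s c => aeval a (w s c)) ≤ LinearMap.ker φ := by
      rw [Submodule.span_le]
      rintro _ ⟨s, rfl⟩
      have : (fun c => aeval a (w s c)) = fun c : Fin (d ^ 2 + d + 1) =>
          (Polynomial.X ^ (s.2 : ℕ) * evalTail a (s.1 : MvPolynomial _ P)).coeff c := by
        funext c
        exact aeval_coeff_X_pow_mul a _ _ _
      change φ (fun c => aeval a (w s c)) = 0
      rw [this, hφ, Polynomial.eval_mul, hev,
        haS _ s.1.2, mul_zero]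
      refine Nat.lt_succ_of_le (Polynomial.natDegree_mul_le.trans ?_)
      rw [Polynomial.natDegree_X_pow]
      have h1 := s.2.2
      have h2 := (natDegree_evalTail_le a (s.1 : MvPolynomial _ P)).trans (hS _ s.1.2)
      omega
    have h0 := hle hmem
    have : (fun c => aeval a (u c)) = fun c : Fin (d ^ 2 + d + 1) =>
        (evalTail a (g ^ d)).coeff c := by
      funext c
      exact (coeff_evalTail a _ _).symm
    rw [LinearMap.mem_ker, this, hφ, hev, map_pow] at h0
    · exact pow_ne_zero _ hag h0
    · refine Nat.lt_succ_of_le ((natDegree_evalTail_le a _).trans ((totalDegree_pow _ _).trans ?_))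
      nlinarith
  obtain ⟨ρ, r, c, hρ, hc, h0⟩ := exists_minors_of_notMem_span hsep
  rw [Fintype.card_fin] at hρ
  have hρ' : ρ ≤ d ^ 2 + d := Nat.lt_succ_iff.1 hρ
  refine ⟨Set.range fun q : (Fin (ρ + 1) → S × Fin (d ^ 2 + 1)) ×
      (Fin (ρ + 1) → Fin (d ^ 2 + d + 1)) => (Matrix.of fun i j => w (q.1 i) (q.2 j)).det,
    (Matrix.of fun i j => (Fin.cons u (w ∘ r) : Fin (ρ + 1) → _ → _) i (c j)).det,
    ?_, ?_, ?_, ?_, ?_⟩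
  · rintro _ ⟨q, rfl⟩
    refine (totalDegree_det_le _ (fun _ => d) fun i j => hwd _ _).trans ?_
    rw [Finset.sum_const, Finset.card_univ, Fintype.card_fin, smul_eq_mul]
    calc (ρ + 1) * d ≤ (d ^ 2 + d + 1) * d := Nat.mul_le_mul_right d (by omega)
      _ ≤ d ^ 4 := by nlinarith [Nat.pow_le_pow_left hd 2, Nat.pow_le_pow_left hd 3]
  · refine (totalDegree_det_le _ (Fin.cons (d ^ 2) fun _ => d) fun i j => ?_).trans ?_
    · induction i using Fin.cases with
      | zero => exact hud _
      | succ i => exact hwd _ _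
    · rw [Fin.sum_univ_succ]
      simp only [Fin.cons_zero, Fin.cons_succ, Finset.sum_const, Finset.card_univ,
        Fintype.card_fin, smul_eq_mul]
      calc d ^ 2 + ρ * d ≤ d ^ 2 + (d ^ 2 + d) * d := by gcongr
        _ ≤ d ^ 4 := by nlinarith [Nat.pow_le_pow_left hd 2, Nat.pow_le_pow_left hd 3]
  · rintro _ ⟨q, rfl⟩
    rw [AlgHom.map_det]
    exact h0 q.1 q.2
  · rw [aeval_det_cons]
    exact hc
  · intro L _ _ b hbS hbg hmem
    have hnot : (fun c => aeval b (u c)) ∉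
        Submodule.span L (Set.range fun s c => aeval b (w s c)) := by
      refine notMem_span_of_minors (r := r) (c := c) ?_ fun r' c' => ?_
      · rw [aeval_det_cons] at hbg
        exact hbg
      · have := hbS _ ⟨(r', c'), rfl⟩
        rw [AlgHom.map_det] at this
        exact this
    refine hnot ?_
    have hmem' := mem_span_X_pow_mul_of_mem_ideal_span (d := d) (m := d ^ 2)
      (fun f : S => (natDegree_evalTail_le b _).trans (hS _ f.2)) (by nlinarith) ?_ hmem
    · have := Submodule.mem_map_of_mem (f := toFn (d ^ 2 + d + 1)) hmem'
      rw [Submodule.map_span, ← Set.range_comp] at this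
      convert this using 1
      · congr 2
        funext s c
        exact aeval_coeff_X_pow_mul b _ _ _
      · funext c
        rw [← map_pow]
        exact (coeff_evalTail b _ _).symm
    · rw [← map_pow]
      refine (natDegree_evalTail_le b _).trans ((totalDegree_pow _ _).trans ?_)
      nlinarith

/-- A system of equations `S` and one inequation `g` that is solvable in some extension of `P` is
solvable in an extension of bounded degree. -/
theorem exists_solution_finrank_le {P : Type v} {K : Type*} [Field P] [Field K] [Algebra P K]
    (k : ℕ) {d : ℕ} (hd : 3 ≤ d) (S : Set (MvPolynomial (Fin k) P)) (g : MvPolynomial (Fin k) P)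
    (hS : ∀ f ∈ S, f.totalDegree ≤ d) (hg : g.totalDegree ≤ d) (a : Fin k → K)
    (haS : ∀ f ∈ S, aeval a f = 0) (hag : aeval a g ≠ 0) :
    ∃ (L : Type v) (_ : Field L) (_ : Algebra P L), FiniteDimensional P L ∧
      Module.finrank P L ≤ d ^ (4 ^ k - 1) ∧
      ∃ b : Fin k → L, (∀ f ∈ S, aeval b f = 0) ∧ aeval b g ≠ 0 := by
  induction k generalizing d with
  | zero =>
    have hb : ∀ f : MvPolynomial (Fin 0) P,
        aeval a f = algebraMap P K (aeval (Fin.elim0 : Fin 0 → P) f) := fun f => by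
      rw [← aeval_algebraMap_apply]
      congr 2
      exact Subsingleton.elim _ _
    refine ⟨P, inferInstance, inferInstance, inferInstance, by simp, Fin.elim0,
      fun f hf => ?_, fun h => hag ?_⟩
    · have := haS f hf
      rwa [hb, map_eq_zero] at this
    · rw [hb, h, map_zero]
  | succ k ih =>
    obtain ⟨x, a, rfl⟩ : ∃ x a', a = (Fin.cons x a' : Fin (k + 1) → K) :=
      ⟨a 0, Fin.tail a, (Fin.cons_self_tail a).symm⟩
    obtain ⟨S', g', hS', hg', haS', hag', hext⟩ :=
      exists_elimination.{v} hd S g hS hg x a haS hag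
    obtain ⟨F, _, _, _, hF, b, hbS, hbg⟩ :=
      ih (d := d ^ 4) (hd.trans (Nat.le_self_pow (by norm_num) d)) S' g' hS' hg' a haS' hag'
    obtain ⟨L, _, _, _, hL, y, hyS, hyg⟩ := exists_extension_root (d := d)
      (by rintro _ ⟨f, rfl⟩; exact (natDegree_evalTail_le b _).trans (hS _ f.2))
      ((natDegree_evalTail_le b _).trans hg) (by omega) (hext F b hbS hbg)
    let _ : Algebra P L := ((algebraMap F L).comp (algebraMap P F)).toAlgebra
    have : IsScalarTower P F L := IsScalarTower.of_algebraMap_eq fun _ => rfl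
    refine ⟨L, inferInstance, inferInstance, FiniteDimensional.trans P F L, ?_,
      Fin.cons y fun i => algebraMap F L (b i), fun f hf => ?_, ?_⟩
    · rw [← Module.finrank_mul_finrank P F L]
      have h4 : 0 < 4 ^ k := by positivity
      calc Module.finrank P F * Module.finrank F L ≤ (d ^ 4) ^ (4 ^ k - 1) * d ^ 2 :=
            Nat.mul_le_mul hF (hL.trans (by nlinarith))
        _ = d ^ (4 * (4 ^ k - 1) + 2) := by rw [← pow_mul, ← pow_add]
        -- The left exponent is `4 ^ (k + 1) - 2`.
        _ ≤ d ^ (4 ^ (k + 1) - 1) := Nat.pow_le_pow_right (by omega) (by rw [pow_succ]; omega)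
    · rw [aeval_cons_eq_aeval_evalTail]
      exact hyS _ ⟨⟨f, hf⟩, rfl⟩
    · rwa [aeval_cons_eq_aeval_evalTail]

end MvPolynomial

end Elimination

/-! ### The polynomial system of a vector configuration -/

theorem MvPolynomial.aeval_det_of_X {R S σ ι : Type*} [CommRing R] [CommRing S] [Algebra R S]
    [Fintype ι] [DecidableEq ι] (x : ι → ι → σ) (b : σ → S) :
    aeval b (Matrix.of fun i j => (X (x i j) : MvPolynomial σ R)).det =
      (Matrix.of fun i j => b (x i j)).det := by
  rw [AlgHom.map_det]
  congr 1
  ext i j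
  simp

open MvPolynomial in
/-- The linear dependencies of `n` vectors in a space of dimension less than `n` over an extension
of `P` are realised over an extension of `P` of bounded degree. -/
theorem exists_linearIndepOn_iff_finrank_le {P : Type v} {K E : Type*} [Field P] [Field K]
    [Algebra P K] [Fintype E] {r : ℕ} (hr : r < Fintype.card E) (A : E → Fin r → K) :
    ∃ (L : Type v) (_ : Field L) (_ : Algebra P L), FiniteDimensional P L ∧
      Module.finrank P L ≤ 2 ^ (2 ^ (2 * Fintype.card E ^ 2)) ∧
      ∃ B : E → Fin r → L, ∀ I : Set E, LinearIndepOn K A I ↔ LinearIndepOn L B I := by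
  classical
  set n := Fintype.card E with hn
  let e : E × Fin r ≃ Fin (n * r) := Fintype.equivOfCardEq (by simp [hn])
  let minor (I : Set E) (c : I → Fin r) : MvPolynomial (Fin (n * r)) P :=
    (Matrix.of fun i j : I => (X (e (i, c j)) : MvPolynomial (Fin (n * r)) P)).det
  have hminor : ∀ (I : Set E) (c : I → Fin r), (minor I c).totalDegree ≤ n := fun I c => by
    refine (totalDegree_det_le _ (fun _ => 1) fun i j => ?_).trans ?_
    · exact (totalDegree_X _).le
    · simpa [hn] using set_fintype_card_le_univ I
  have hindep : ∀ I : {I : Set E // LinearIndepOn K A I}, ∃ c : I.1 → Fin r,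
      (Matrix.of fun i j : I.1 => A i (c j)).det ≠ 0 := fun I =>
    (linearIndependent_iff_exists_det_ne_zero fun i : I.1 => A i).1 I.2
  choose c hc using hindep
  -- The inequation is a product of at most `2 ^ n` minors of degree at most `n`. Rounding up to `2
  -- ^ 4 ^ n` makes the final exponents combine.
  have hbound : n * 2 ^ n ≤ 2 ^ 4 ^ n := by
    calc n * 2 ^ n ≤ 2 ^ n * 2 ^ n := Nat.mul_le_mul_right _ Nat.lt_two_pow_self.le
      _ = 2 ^ (2 * n) := by ring
      _ ≤ 2 ^ 2 ^ (2 * n) := Nat.pow_le_pow_right (by norm_num) Nat.lt_two_pow_self.le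
      _ = 2 ^ 4 ^ n := by rw [pow_mul]; norm_num
  have hn_le : n ≤ n * 2 ^ n := Nat.le_mul_of_pos_right n (by positivity)
  have h3 : 3 ≤ 2 ^ 4 ^ n := by
    calc 3 ≤ 2 ^ 4 ^ 1 := by norm_num
      _ ≤ 2 ^ 4 ^ n := Nat.pow_le_pow_right (by norm_num)
        (Nat.pow_le_pow_right (by norm_num) (by omega))
  let a : Fin (n * r) → K := fun i => A (e.symm i).1 (e.symm i).2
  obtain ⟨L, _, _, hfin, hL, b, hbS, hbg⟩ := exists_solution_finrank_le (n * r) h3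
    {f | ∃ (I : Set E) (c : I → Fin r), ¬ LinearIndepOn K A I ∧ f = minor I c}
    (∏ I : {I : Set E // LinearIndepOn K A I}, minor I.1 (c I))
    (by rintro _ ⟨I, c, -, rfl⟩; exact (hminor I c).trans (hn_le.trans hbound))
    (by
      refine (totalDegree_finsetProd _ _).trans ((Finset.sum_le_card_nsmul _ _ n
        fun I _ => hminor _ _).trans (le_trans ?_ hbound))
      rw [smul_eq_mul, mul_comm]
      refine Nat.mul_le_mul_left n ?_
      rw [Finset.card_univ, hn, ← Fintype.card_set]
      exact Fintype.card_subtype_le _)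
    a
    (by
      rintro _ ⟨I, c, hI, rfl⟩
      rw [aeval_det_of_X]
      by_contra h
      refine hI ((linearIndependent_iff_exists_det_ne_zero fun i : I => A i).2 ⟨c, ?_⟩)
      simpa [a] using h)
    (by
      rw [map_prod, Finset.prod_ne_zero_iff]
      intro I _
      rw [aeval_det_of_X]
      simpa [a] using hc I)
  refine ⟨L, inferInstance, inferInstance, hfin, hL.trans ?_, fun i j => b (e (i, j)), fun I => ?_⟩
  · rw [← pow_mul]
    refine Nat.pow_le_pow_right (by norm_num) ?_
    calc 4 ^ n * (4 ^ (n * r) - 1) ≤ 4 ^ n * 4 ^ (n * r) := Nat.mul_le_mul_left _ (Nat.sub_le _ _)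
      _ = 4 ^ (n * (r + 1)) := by ring
      -- The strict inequality `r < n` absorbs the factor `4 ^ n` coming from the initial degree.
      _ ≤ 4 ^ (n * n) := Nat.pow_le_pow_right (by norm_num) (Nat.mul_le_mul_left n hr)
      _ = 2 ^ (2 * n ^ 2) := by rw [pow_mul 2 2]; ring_nf
  · constructor
    · intro hI
      rw [map_prod, Finset.prod_ne_zero_iff] at hbg
      have := hbg ⟨I, hI⟩ (Finset.mem_univ _)
      rw [aeval_det_of_X] at this
      exact (linearIndependent_iff_exists_det_ne_zero fun i : I => fun j => b (e (i, j))).2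
        ⟨_, this⟩
    · intro hI
      by_contra hnot
      obtain ⟨c, hc⟩ :=
        (linearIndependent_iff_exists_det_ne_zero fun i : I => fun j => b (e (i, j))).1 hI
      have := hbS _ ⟨I, c, hnot, rfl⟩
      rw [aeval_det_of_X] at this
      exact hc this

/-! ### Prime fields and reduction to dimension below `n` -/

/-- The prime field is finite or of characteristic zero. Perfectness makes the primitive element
theorem applicable. -/
instance Subfield.perfectField_bot (K : Type*) [Field K] : PerfectField (⊥ : Subfield K) := by
  obtain ⟨p, hp⟩ := CharP.exists K
  rcases CharP.char_is_prime_or_zero K p with h | rfl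
  · have := Fact.mk h
    let _ := ZMod.algebra K p
    have : Finite (⊥ : Subfield K) := by
      rw [Subfield.bot_eq_of_zMod_algebra p]
      exact Set.finite_range (algebraMap (ZMod p) K)
    infer_instance
  · have := CharP.charP_to_charZero K
    have : CharZero (⊥ : Subfield K) :=
      (algebraMap (⊥ : Subfield K) K).charZero
    infer_instance

theorem isSimpleAlgebraicExtension_of_finiteDimensional (k : Type u) (L : Type v) [Field k]
    [PerfectField k] [Field L] [Algebra k L] [FiniteDimensional k L] :
    IsSimpleAlgebraicExtension k L := by
  obtain ⟨a, ha⟩ := Field.exists_primitive_element k L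
  exact ⟨a, Algebra.IsAlgebraic.isAlgebraic a, ha⟩

/-- Handles the one case where rank below `n` is unavailable, using distinct standard basis vectors.
-/
theorem Matroid.isRepresentableOver_of_indep_ground {α : Type u} {M : Matroid α}
    (hfin : M.E.Finite) (hM : M.Indep M.E) (F : Type v) [Field F] : M.IsRepresentableOver F := by
  classical
  have := hfin.fintype
  let e := Fintype.equivFin M.E
  let v : α → Fin (Fintype.card M.E) → F := fun x =>
    if hx : x ∈ M.E then Pi.single (e ⟨x, hx⟩) 1 else 0
  have hv : LinearIndepOn F v M.E := by
    have : (fun x : M.E => v x) = (Pi.basisFun F (Fin (Fintype.card M.E))) ∘ e := by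
      funext x
      simp [v]
    rw [LinearIndepOn, this]
    exact (Pi.basisFun F _).linearIndependent.comp _ e.injective
  exact ⟨_, fun i x => v x i, fun I hI => ⟨fun _ => hv.mono hI, fun _ => hM.subset hI⟩⟩

/-- A family with `n` linearly dependent members can be represented in dimension less than `n`. -/
theorem exists_linearIndepOn_iff_of_not_linearIndependent {K V E : Type*} [Field K]
    [AddCommGroup V] [Module K V] [Fintype E] {v : E → V} (hv : ¬ LinearIndependent K v) :
    ∃ r < Fintype.card E, ∃ A : E → Fin r → K,
      ∀ I : Set E, LinearIndepOn K A I ↔ LinearIndepOn K v I := by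
  let W := Submodule.span K (Set.range v)
  have hlt : Module.finrank K W < Fintype.card E := by
    by_contra h
    exact hv (linearIndependent_iff_card_le_finrank_span.2 (not_lt.1 h))
  let w : E → W := fun i => ⟨v i, Submodule.subset_span ⟨i, rfl⟩⟩
  have : Module.Finite K W := Module.Finite.span_of_finite K (Set.finite_range v)
  let φ := (Module.finBasis K W).equivFun
  refine ⟨_, hlt, φ ∘ w, fun I => ?_⟩
  have h1 : LinearIndepOn K (φ ∘ w) I ↔ LinearIndepOn K w I :=
    φ.toLinearMap.linearIndepOn_iff_of_injOn φ.injective.injOn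
  have h2 : LinearIndepOn K (W.subtype ∘ w) I ↔ LinearIndepOn K w I :=
    W.subtype.linearIndepOn_iff_of_injOn W.injective_subtype.injOn
  exact h1.trans h2.symm

theorem linearIndepOn_comp_subtype_val_iff {R M α : Type*} [Semiring R] [AddCommMonoid M]
    [Module R M] {s : Set α} (v : α → M) (I : Set s) :
    LinearIndepOn R (fun x : s => v x) I ↔ LinearIndepOn R v (Subtype.val '' I) :=
  ⟨fun h => LinearIndepOn.image_of_comp Subtype.val v h,
    fun h => h.comp_of_image Subtype.val_injective.injOn⟩

/-- `(⊥ : Subfield K)` is the prime field of `K`. -/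
theorem theorem1p1 {α : Type u} (M : Matroid α) (n : ℕ) (hn : M.E.encard = n)
    (K : Type v) [Field K] (hM : M.IsRepresentableOver K) :
    ∃ (L : Type v) (_ : Field L) (_ : Algebra (⊥ : Subfield K) L),
      IsSimpleAlgebraicExtension (⊥ : Subfield K) L ∧
      FiniteDimensional (⊥ : Subfield K) L ∧
      Module.finrank (⊥ : Subfield K) L ≤ 2 ^ (2 ^ (2 * n ^ 2)) ∧
      M.IsRepresentableOver L := by
  classical
  have hfin : M.E.Finite := Set.finite_of_encard_eq_coe hn
  have := hfin.fintype
  have hcard : Fintype.card M.E = n := by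
    rw [Set.encard_eq_coe_toFinset_card, Set.toFinset_card] at hn
    exact_mod_cast hn
  by_cases hfree : M.Indep M.E
  · refine ⟨(⊥ : Subfield K), inferInstance, inferInstance,
      isSimpleAlgebraicExtension_of_finiteDimensional _ _, inferInstance, ?_,
      M.isRepresentableOver_of_indep_ground hfin hfree _⟩
    rw [Module.finrank_self]
    exact Nat.one_le_two_pow
  obtain ⟨m, A, hA⟩ := hM
  have hdep : ¬ LinearIndependent K fun x : M.E => A.col x := fun h =>
    hfree ((hA _ subset_rfl).2 h)
  obtain ⟨r, hr, A', hA'⟩ := exists_linearIndepOn_iff_of_not_linearIndependent hdep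
  obtain ⟨L, _, _, _, hL, B, hB⟩ :=
    exists_linearIndepOn_iff_finrank_le (P := (⊥ : Subfield K)) hr A'
  refine ⟨L, inferInstance, inferInstance, isSimpleAlgebraicExtension_of_finiteDimensional _ _,
    inferInstance, hcard ▸ hL, r, fun i x => if hx : x ∈ M.E then B ⟨x, hx⟩ i else 0, ?_⟩
  intro I hI
  obtain ⟨J, rfl⟩ : ∃ J : Set M.E, Subtype.val '' J = I :=
    ⟨Subtype.val ⁻¹' I, by simpa using hI⟩
  rw [hA _ hI, ← linearIndepOn_comp_subtype_val_iff, ← hA', hB,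
    ← linearIndepOn_comp_subtype_val_iff]
  have : (fun x : M.E => (Matrix.col (fun i x => if hx : x ∈ M.E then B ⟨x, hx⟩ i else 0 :
      Matrix (Fin r) α L)) x) = B := by
    funext x i
    exact dif_pos x.2
  rw [this]
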